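/- **Setting.** Every finite-dimensional system carries a fixed orthonormal basis. A state (density matrix) is *incoherent* if it is diagonal in that basis and *coherent* otherwise; composite systems carry the product basis. An *incoherent operation* is a completely positive trace-preserving map which either (reading 1) maps every incoherent state to an incoherent state, or (reading 2) has a Kraus representation $\Phi(X)=\sum_k K_kXK_k^\dagger$, $\sum_k K_k^\dagger K_k=\mathbb 1$, in which every $K_k\sigma K_k^\dagger$ is diagonal for every incoherent $\sigma$. The theorem below holds for each of the two readings. Let $h^{(1)},h^{(2)},\dots$ be a fixed sequence (not depending on $N$) of Hermitian operators, $h^{(i)}$ acting on a particle of finite dimension $d_i$ whose fixed basis consists of eigenvectors of $h^{(i)}$. Assume that the spectral spreads $\phi_i=\lambda_{\max}(h^{(i)})-\lambda_{\min}(h^{(i)})$ satisfy $0<m\le\phi_i\le M<\infty$ for all $i$, with $m,M$ independent of $i$. Let $H_N=\sum_{i=1}^N h^{(i)}$, each $h^{(i)}$ acting on the $i$-th of $N$ particles. For a state $\rho$ with eigenvalues $\lambda_i$ and orthonormal eigenvectors $|i\rangle$, the quantum Fisher information is $$\mathcal F(\rho,H)=2\sum_{i,j:\ \lambda_i+\lambda_j>0}\frac{(\lambda_i-\lambda_j)^2}{\lambda_i+\lambda_j}\,|\langle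 i|H|j\rangle|^2 .$$ For a unit vector $\psi$ of a finite-dimensional system $S$ put $$\mathcal C^{1}_{F,N}(\psi)=\sup_{\Phi}\ \mathcal F\big(\Phi(|\psi\rangle\langle\psi|),\,H_N\otimes\mathbb 1_A\big),$$ the supremum being over all incoherent operations $\Phi$ from $S$ to the $N$ particles together with an ancilla $A$ of arbitrary finite dimension, and for a state $\rho$ of $S$ put $\mathcal C^1_{F,N}(\rho)=\inf\sum_k p_k\,\mathcal C^1_{F,N}(\psi_k)$, the infimum being over all finite pure-state decompositions $\rho=\sum_k p_k|\psi_k\rangle\langle\psi_k|$. **Theorem.** For every state $\rho$ of every finite-dimensional system $S$, the limit $\lim_{N\to\infty}\frac{\log\mathcal C^1_{F,N}(\rho)}{\log N}$ exists in $[-\infty,\infty]$ (with $\log 0=-\infty$), and the asymptotic QFI coherence $$\mathcal C_{AF}(\rho)=\max\Big(\lim_{N\to\infty}\frac{\log\mathcal C^1_{F,N}(\rho)}{\log N}-1,\ 0\Big)$$ equals $1$ if and only if $\rho$ is coherent, and equals $0$ if and only if $\rho$ is incoherent. -/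

import Mathlib

open Filter Topology
open scoped ENNReal NNReal Matrix Kronecker ComplexOrder

noncomputable section

/-- Density matrices on the system with (fixed, incoherent) basis labelled by `n`. -/
def IsState {n : Type*} [Fintype n] (ρ : Matrix n n ℂ) : Prop :=
  ρ.PosSemidef ∧ ρ.trace = 1

/-- Incoherent states: density matrices that are diagonal in the fixed basis. -/
def IsIncoherent {n : Type*} [Fintype n] (ρ : Matrix n n ℂ) : Prop :=
  IsState ρ ∧ ρ.IsDiag

/-- Coherent states: density matrices that are not incoherent. -/
def IsCoherent {n : Type*} [Fintype n] (ρ : Matrix n n ℂ) : Prop :=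
  IsState ρ ∧ ¬ IsIncoherent ρ

/-- `K` is a family of Kraus operators of the completely positive trace preserving map `Φ`. -/
def IsKrausFamily {m n : Type*} [Fintype m] [Fintype n] [DecidableEq m] {r : ℕ}
    (K : Fin r → Matrix n m ℂ) (Φ : Matrix m m ℂ →ₗ[ℂ] Matrix n n ℂ) : Prop :=
  (∑ k, (K k)ᴴ * K k = 1) ∧ ∀ X, Φ X = ∑ k, K k * X * (K k)ᴴ

/-- The two usual readings of "incoherent operation". -/
inductive IncoherentOpClass
  /-- CPTP maps that send every incoherent state to an incoherent state. -/
  | preserving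
  /-- CPTP maps with Kraus operators each of which keeps incoherent states diagonal. -/
  | kraus

/-- Incoherent completely positive trace preserving maps, for either reading. -/
def IsICPTP {m n : Type*} [Fintype m] [Fintype n] [DecidableEq m] (c : IncoherentOpClass)
    (Φ : Matrix m m ℂ →ₗ[ℂ] Matrix n n ℂ) : Prop :=
  match c with
  | .preserving =>
      (∃ (r : ℕ) (K : Fin r → Matrix n m ℂ), IsKrausFamily K Φ) ∧
        ∀ σ : Matrix m m ℂ, IsIncoherent σ → IsIncoherent (Φ σ)
  | .kraus =>
      ∃ (r : ℕ) (K : Fin r → Matrix n m ℂ), IsKrausFamily K Φ ∧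
        ∀ k (σ : Matrix m m ℂ), IsIncoherent σ → (K k * σ * (K k)ᴴ).IsDiag

/-- Quantum Fisher information
`2 ∑ i j, (λᵢ - λⱼ)² / (λᵢ + λⱼ) |⟨i| H |j⟩|²`, where `λᵢ`, `|i⟩` are the eigenvalues and an
orthonormal eigenbasis (the columns of `U`) of `ρ`; as usual only the terms with `λᵢ + λⱼ ≠ 0`
count. The value `0` for non-Hermitian `ρ` is a dummy value. -/
def qfi {n : Type*} [Fintype n] [DecidableEq n] (ρ H : Matrix n n ℂ) : ℝ :=
  open scoped Classical in
  if hρ : ρ.IsHermitian then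
    let lam : n → ℝ := hρ.eigenvalues
    let U : Matrix n n ℂ := (hρ.eigenvectorUnitary : Matrix n n ℂ)
    2 * ∑ i, ∑ j, (lam i - lam j) ^ 2 / (lam i + lam j) * ‖(Uᴴ * H * U) i j‖ ^ 2
  else 0

/-- Labels of the product basis of the first `N` particles, the `i`-th of dimension `d i`. -/
abbrev Config (d : ℕ → ℕ) (N : ℕ) : Type := (i : Fin N) → Fin (d i)

/-- The operator acting as `A` on particle `i` and as the identity on all other particles. -/
def localOp {d : ℕ → ℕ} {N : ℕ} (i : Fin N) (A : Matrix (Fin (d i)) (Fin (d i)) ℂ) :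
    Matrix (Config d N) (Config d N) ℂ :=
  Matrix.of fun x y => if ∀ j, j ≠ i → x j = y j then A (x i) (y i) else 0

/-- The signal Hamiltonian `∑_{i < N} h⁽ⁱ⁾` on `N` particles. -/
def signalHamiltonian {d : ℕ → ℕ} (h : (i : ℕ) → Matrix (Fin (d i)) (Fin (d i)) ℂ) (N : ℕ) :
    Matrix (Config d N) (Config d N) ℂ :=
  ∑ i : Fin N, localOp i (h i)

/-- The diameter of the spectrum; for a Hermitian matrix, its largest minus its smallest
eigenvalue. -/
def spectralSpread {n : Type*} [Fintype n] [DecidableEq n] (A : Matrix n n ℂ) : ℝ :=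
  Metric.diam (spectrum ℂ A)

/-- The rank one operator `|ψ⟩⟨ψ|`. -/
def ketbra {n : Type*} (ψ : n → ℂ) : Matrix n n ℂ :=
  Matrix.vecMulVec ψ (star ψ)

/-- `C_F^1` of a pure state: the supremum of the quantum Fisher information with respect to the
`N`-particle signal Hamiltonian over all incoherent operations, whose output consists of the `N`
particles together with an ancilla of any finite dimension `a` that the signal does not touch. -/
def qfiCoherencePure {S : Type*} [Fintype S] [DecidableEq S] {d : ℕ → ℕ} (c : IncoherentOpClass)
    (h : (i : ℕ) → Matrix (Fin (d i)) (Fin (d i)) ℂ) (N : ℕ) (ψ : S → ℂ) : ℝ≥0∞ :=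
  ⨆ (a : ℕ) (Φ : Matrix S S ℂ →ₗ[ℂ] Matrix (Config d N × Fin a) (Config d N × Fin a) ℂ)
    (_ : IsICPTP c Φ),
    ENNReal.ofReal
      (qfi (Φ (ketbra ψ)) (signalHamiltonian h N ⊗ₖ (1 : Matrix (Fin a) (Fin a) ℂ)))

/-- `ρ = ∑ₖ pₖ |ψₖ⟩⟨ψₖ|` with a probability vector `p` and unit vectors `ψₖ`. -/
def IsPureDecomposition {S : Type*} [Fintype S] (ρ : Matrix S S ℂ) {r : ℕ}
    (p : Fin r → ℝ≥0) (ψ : Fin r → S → ℂ) : Prop :=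
  ∑ k, p k = 1 ∧ (∀ k, ∑ s, ‖ψ k s‖ ^ 2 = 1) ∧ ρ = ∑ k, ((p k : ℝ) : ℂ) • ketbra (ψ k)

/-- `C_F^1` of a mixed state: the convex roof of `qfiCoherencePure`. -/
def qfiCoherence {S : Type*} [Fintype S] [DecidableEq S] {d : ℕ → ℕ} (c : IncoherentOpClass)
    (h : (i : ℕ) → Matrix (Fin (d i)) (Fin (d i)) ℂ) (N : ℕ) (ρ : Matrix S S ℂ) : ℝ≥0∞ :=
  ⨅ (r : ℕ) (p : Fin r → ℝ≥0) (ψ : Fin r → S → ℂ) (_ : IsPureDecomposition ρ p ψ),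
    ∑ k, (p k : ℝ≥0∞) * qfiCoherencePure c h N (ψ k)

/-- `log C_F^1(ρ) / log N` as an extended real number, with `log 0 = -∞`. -/
def qfiLogRatio {S : Type*} [Fintype S] [DecidableEq S] {d : ℕ → ℕ} (c : IncoherentOpClass)
    (h : (i : ℕ) → Matrix (Fin (d i)) (Fin (d i)) ℂ) (ρ : Matrix S S ℂ) (N : ℕ) : EReal :=
  ENNReal.log (qfiCoherence c h N ρ) / ENNReal.log (N : ℝ≥0∞)

/-- The asymptotic QFI coherence `max (lim_N log C_F^1(ρ) / log N - 1, 0)`. -/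
def asymptoticQFICoherence {S : Type*} [Fintype S] [DecidableEq S] {d : ℕ → ℕ}
    (c : IncoherentOpClass) (h : (i : ℕ) → Matrix (Fin (d i)) (Fin (d i)) ℂ)
    (ρ : Matrix S S ℂ) : EReal :=
  max (limUnder atTop (qfiLogRatio c h ρ) - 1) 0

end

/-! For coherent states `qfiCoherence` lies between two positive multiples of `N ^ 2`, and for
incoherent states it is exactly `0`. The logarithmic ratio therefore tends to `2` or to `⊥`, and no
intermediate growth rate occurs.

The signal Hamiltonian is diagonal in the product basis, with diagonal `w` say. If `w` stays within
`B` of a constant, the QFI is at most `4 * B ^ 2` (`qfi_diagonal_le`); bounded spreads give `B = N *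
M`. Conversely, one off-diagonal entry already forces QFI: the commutator entry `ρ x y * (w y - w
x)`, expanded in an eigenbasis, is controlled by Cauchy–Schwarz (`norm_sq_mul_le_qfi_diagonal`).

A nonzero entry of a state of `S` can be moved by an incoherent operation to a pair of product
configurations whose energies differ by at least `N * (m / 2)` (`exists_isICPTP_apply_eq`). This
gives the quadratic lower bound for pure states, and convexity carries it through every
decomposition (`le_qfiCoherence`). An incoherent state is a mixture of basis vectors; their images
stay diagonal, commute with the Hamiltonian and have zero QFI. -/

/-! ### Eigenbasis identities and unitary conjugation -/

namespace Matrix.IsHermitian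

variable {n : Type*} [Fintype n] [DecidableEq n] {ρ : Matrix n n ℂ}

theorem conjTranspose_eigenvectorUnitary_mul (hρ : ρ.IsHermitian) :
    (hρ.eigenvectorUnitary : Matrix n n ℂ)ᴴ * (hρ.eigenvectorUnitary : Matrix n n ℂ) = 1 :=
  Unitary.coe_star_mul_self hρ.eigenvectorUnitary

theorem eigenvectorUnitary_mul_conjTranspose (hρ : ρ.IsHermitian) :
    (hρ.eigenvectorUnitary : Matrix n n ℂ) * (hρ.eigenvectorUnitary : Matrix n n ℂ)ᴴ = 1 :=
  Unitary.coe_mul_star_self hρ.eigenvectorUnitary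

theorem eq_conj_diagonal (hρ : ρ.IsHermitian) :
    ρ = (hρ.eigenvectorUnitary : Matrix n n ℂ) * Matrix.diagonal (fun i => (hρ.eigenvalues i : ℂ)) *
      (hρ.eigenvectorUnitary : Matrix n n ℂ)ᴴ := by
  conv_lhs => rw [hρ.spectral_theorem, Unitary.conjStarAlgAut_apply]
  rfl

/-- The entries of a commutator in the eigenbasis. -/
theorem conj_commutator_apply (hρ : ρ.IsHermitian) (H : Matrix n n ℂ) (i j : n) :
    ((hρ.eigenvectorUnitary : Matrix n n ℂ)ᴴ * (ρ * H - H * ρ) *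
        (hρ.eigenvectorUnitary : Matrix n n ℂ)) i j =
      ((hρ.eigenvalues i : ℂ) - hρ.eigenvalues j) *
        ((hρ.eigenvectorUnitary : Matrix n n ℂ)ᴴ * H *
          (hρ.eigenvectorUnitary : Matrix n n ℂ)) i j := by
  have h1 := hρ.conjTranspose_eigenvectorUnitary_mul
  have h3 := hρ.eq_conj_diagonal
  set U := (hρ.eigenvectorUnitary : Matrix n n ℂ) with hU
  set D : Matrix n n ℂ := Matrix.diagonal (fun i => (hρ.eigenvalues i : ℂ)) with hD
  have h4 : Uᴴ * ρ = D * Uᴴ := by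
    calc Uᴴ * ρ = Uᴴ * (U * D * Uᴴ) := by rw [← h3]
      _ = (Uᴴ * U) * (D * Uᴴ) := by simp only [Matrix.mul_assoc]
      _ = _ := by rw [h1, Matrix.one_mul]
  have h5 : ρ * U = U * D := by
    calc ρ * U = (U * D * Uᴴ) * U := by rw [← h3]
      _ = (U * D) * (Uᴴ * U) := by simp only [Matrix.mul_assoc]
      _ = _ := by rw [h1, Matrix.mul_one]
  have h6 : Uᴴ * (ρ * H - H * ρ) * U = D * (Uᴴ * H * U) - (Uᴴ * H * U) * D := by
    calc Uᴴ * (ρ * H - H * ρ) * U = (Uᴴ * ρ) * H * U - Uᴴ * H * (ρ * U) := by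
          simp only [Matrix.mul_sub, Matrix.sub_mul, Matrix.mul_assoc]
      _ = _ := by rw [h4, h5]; simp only [Matrix.mul_assoc]
  rw [h6, Matrix.sub_apply, hD, Matrix.diagonal_mul, Matrix.mul_diagonal]
  ring

end Matrix.IsHermitian

section UnitaryConj

variable {n : Type*} [Fintype n] [DecidableEq n]

theorem sum_norm_sq_row (U : Matrix n n ℂ) (hU : U * Uᴴ = 1) (i : n) :
    ∑ j, ‖U i j‖ ^ 2 = 1 := by
  have h := congrFun (congrFun hU i) i
  simp only [Matrix.mul_apply, Matrix.conjTranspose_apply, Matrix.one_apply_eq, RCLike.star_def,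
    Complex.mul_conj'] at h
  exact_mod_cast h

theorem sum_norm_sq_col (U : Matrix n n ℂ) (hU : Uᴴ * U = 1) (j : n) :
    ∑ i, ‖U i j‖ ^ 2 = 1 := by
  have h := sum_norm_sq_row Uᴴ (by rwa [Matrix.conjTranspose_conjTranspose]) j
  simpa using h

/-- The row sum is a diagonal entry of `M * Mᴴ`, and unitarity collapses this product to `Uᴴ |w|²
U`. Such an entry is an average of the `‖w x‖ ^ 2` with weights `‖U x i‖ ^ 2`. -/
theorem sum_norm_sq_row_conj_diagonal_le {U : Matrix n n ℂ} (hU : U * Uᴴ = 1) (hU' : Uᴴ * U = 1)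
    {w : n → ℂ} {B : ℝ} (hw : ∀ x, ‖w x‖ ≤ B) (i : n) :
    ∑ j, ‖(Uᴴ * Matrix.diagonal w * U) i j‖ ^ 2 ≤ B ^ 2 := by
  set M := Uᴴ * Matrix.diagonal w * U with hM
  have h1 : M * Mᴴ = Uᴴ * Matrix.diagonal (fun x => w x * star (w x)) * U := by
    have h2 : Mᴴ = Uᴴ * (Matrix.diagonal (star w) * U) := by
      simp [hM, Matrix.conjTranspose_mul, Matrix.diagonal_conjTranspose]
    calc M * Mᴴ = Uᴴ * Matrix.diagonal w * (U * Uᴴ) * (Matrix.diagonal (star w) * U) := by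
          rw [h2, hM]; simp only [Matrix.mul_assoc]
      _ = Uᴴ * (Matrix.diagonal w * Matrix.diagonal (star w)) * U := by
          rw [hU, Matrix.mul_one]; simp only [Matrix.mul_assoc]
      _ = _ := by rw [Matrix.diagonal_mul_diagonal]; rfl
  have h3 : ∑ j, ‖M i j‖ ^ 2 = ∑ x, ‖w x‖ ^ 2 * ‖U x i‖ ^ 2 := by
    have h4 := congrFun (congrFun h1 i) i
    rw [Matrix.mul_apply, Matrix.mul_apply] at h4
    simp only [Matrix.mul_diagonal, Matrix.conjTranspose_apply, RCLike.star_def,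
      Complex.mul_conj'] at h4
    have h5 : ∀ x, (starRingEnd ℂ) (U x i) * ((‖w x‖ : ℂ) ^ 2) * U x i =
        ((‖w x‖ ^ 2 * ‖U x i‖ ^ 2 : ℝ) : ℂ) := by
      intro x
      push_cast
      rw [← Complex.conj_mul' (U x i)]
      ring
    simp only [h5] at h4
    exact_mod_cast h4
  rw [h3]
  calc ∑ x, ‖w x‖ ^ 2 * ‖U x i‖ ^ 2 ≤ ∑ x, B ^ 2 * ‖U x i‖ ^ 2 := by
        gcongr with x
        exact hw x
    _ = B ^ 2 := by rw [← Finset.mul_sum, sum_norm_sq_col U hU', mul_one]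

theorem sum_norm_sq_col_conj_diagonal_le {U : Matrix n n ℂ} (hU : U * Uᴴ = 1) (hU' : Uᴴ * U = 1)
    {w : n → ℂ} {B : ℝ} (hw : ∀ x, ‖w x‖ ≤ B) (j : n) :
    ∑ i, ‖(Uᴴ * Matrix.diagonal w * U) i j‖ ^ 2 ≤ B ^ 2 := by
  have h := sum_norm_sq_row_conj_diagonal_le hU hU' (w := star w) (B := B) (by simpa using hw) j
  have h2 : Uᴴ * Matrix.diagonal (star w) * U = (Uᴴ * Matrix.diagonal w * U)ᴴ := by
    simp [Matrix.conjTranspose_mul, Matrix.diagonal_conjTranspose, Matrix.mul_assoc]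
  rw [h2] at h
  simpa using h

end UnitaryConj

/-! ### Bounds on the quantum Fisher information -/

section QFI

variable {n : Type*} [Fintype n] [DecidableEq n] {ρ : Matrix n n ℂ}

theorem IsState.sum_eigenvalues (hρ : IsState ρ) : ∑ i, hρ.1.isHermitian.eigenvalues i = 1 := by
  have h := hρ.1.isHermitian.trace_eq_sum_eigenvalues.symm.trans hρ.2
  have h' : ((∑ i, hρ.1.isHermitian.eigenvalues i : ℝ) : ℂ) = 1 := by
    push_cast; exact h
  exact_mod_cast h'

theorem qfi_eq (hρ : ρ.IsHermitian) (H : Matrix n n ℂ) :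
    qfi ρ H = 2 * ∑ i, ∑ j, (hρ.eigenvalues i - hρ.eigenvalues j) ^ 2 /
      (hρ.eigenvalues i + hρ.eigenvalues j) *
      ‖((hρ.eigenvectorUnitary : Matrix n n ℂ)ᴴ * H *
        (hρ.eigenvectorUnitary : Matrix n n ℂ)) i j‖ ^ 2 := by
  rw [qfi, dif_pos hρ]

/-- The quantum Fisher information vanishes on states commuting with the Hamiltonian. -/
theorem qfi_eq_zero_of_commute (hρ : ρ.IsHermitian) {H : Matrix n n ℂ} (hc : ρ * H = H * ρ) :
    qfi ρ H = 0 := by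
  rw [qfi_eq hρ]
  have key : ∀ i j, (hρ.eigenvalues i - hρ.eigenvalues j) ^ 2 /
      (hρ.eigenvalues i + hρ.eigenvalues j) *
      ‖((hρ.eigenvectorUnitary : Matrix n n ℂ)ᴴ * H *
        (hρ.eigenvectorUnitary : Matrix n n ℂ)) i j‖ ^ 2 = 0 := by
    intro i j
    have h := hρ.conj_commutator_apply H i j
    rw [hc, sub_self, Matrix.mul_zero, Matrix.zero_mul, Matrix.zero_apply] at h
    rcases mul_eq_zero.1 h.symm with h | h
    · have h' : hρ.eigenvalues i - hρ.eigenvalues j = 0 := by exact_mod_cast h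
      simp [h']
    · simp [h]
  simp [key]

/-- Since `(λᵢ - λⱼ)² ≤ (λᵢ + λⱼ)²`, each coefficient is at most `λᵢ + λⱼ`. The two halves are then
averages, with the eigenvalues as weights, of row and column sums bounded by `B ^ 2`. -/
theorem qfi_diagonal_le (hρ : IsState ρ) {w : n → ℂ} (c : ℂ) {B : ℝ}
    (hw : ∀ x, ‖w x - c‖ ≤ B) : qfi ρ (Matrix.diagonal w) ≤ 4 * B ^ 2 := by
  have hh := hρ.1.isHermitian
  have h0 := hρ.1.eigenvalues_nonneg
  have hsum := hρ.sum_eigenvalues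
  have hU := hh.eigenvectorUnitary_mul_conjTranspose
  have hU' := hh.conjTranspose_eigenvectorUnitary_mul
  rw [qfi_eq hh]
  set U := (hh.eigenvectorUnitary : Matrix n n ℂ) with hUdef
  set l := hh.eigenvalues with hl
  -- Subtracting the scalar `c` changes only diagonal entries, which carry coefficient zero in the
  -- QFI.
  have hoff : ∀ i j, i ≠ j → (Uᴴ * Matrix.diagonal w * U) i j =
      (Uᴴ * Matrix.diagonal (fun x => w x - c) * U) i j := by
    intro i j hij
    have h1 : Matrix.diagonal (fun x => w x - c) = Matrix.diagonal w - c • (1 : Matrix n n ℂ) := by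
      ext x y
      by_cases hxy : x = y
      · subst hxy; simp
      · simp [hxy]
    rw [h1, Matrix.mul_sub, Matrix.sub_mul, Matrix.mul_smul, Matrix.mul_one, Matrix.smul_mul, hU',
      Matrix.sub_apply, Matrix.smul_apply, Matrix.one_apply_ne hij, smul_zero, sub_zero]
  have hterm : ∀ i j, (l i - l j) ^ 2 / (l i + l j) * ‖(Uᴴ * Matrix.diagonal w * U) i j‖ ^ 2 ≤
      l i * ‖(Uᴴ * Matrix.diagonal (fun x => w x - c) * U) i j‖ ^ 2 +
      l j * ‖(Uᴴ * Matrix.diagonal (fun x => w x - c) * U) i j‖ ^ 2 := by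
    intro i j
    have hi : 0 ≤ l i := h0 i
    have hj : 0 ≤ l j := h0 j
    by_cases hij : i = j
    · subst hij
      simp only [sub_self, ne_eq, OfNat.ofNat_ne_zero, not_false_eq_true, zero_pow, zero_div,
        zero_mul]
      positivity
    · rw [hoff i j hij, ← add_mul]
      gcongr
      apply div_le_of_le_mul₀ (by positivity) (by positivity)
      nlinarith [mul_nonneg hi hj]
  have hB1 : ∑ i, ∑ j, l i * ‖(Uᴴ * Matrix.diagonal (fun x => w x - c) * U) i j‖ ^ 2 ≤ B ^ 2 := by
    calc _ ≤ ∑ i, l i * B ^ 2 := by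
          refine Finset.sum_le_sum fun i _ => ?_
          rw [← Finset.mul_sum]
          exact mul_le_mul_of_nonneg_left (sum_norm_sq_row_conj_diagonal_le hU hU' hw i) (h0 i)
      _ = B ^ 2 := by rw [← Finset.sum_mul, hsum, one_mul]
  have hB2 : ∑ i, ∑ j, l j * ‖(Uᴴ * Matrix.diagonal (fun x => w x - c) * U) i j‖ ^ 2 ≤ B ^ 2 := by
    rw [Finset.sum_comm]
    calc _ ≤ ∑ j, l j * B ^ 2 := by
          refine Finset.sum_le_sum fun j _ => ?_
          rw [← Finset.mul_sum]
          exact mul_le_mul_of_nonneg_left (sum_norm_sq_col_conj_diagonal_le hU hU' hw j) (h0 j)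
      _ = B ^ 2 := by rw [← Finset.sum_mul, hsum, one_mul]
  have := Finset.sum_le_sum fun i (_ : i ∈ Finset.univ) =>
    Finset.sum_le_sum fun j (_ : j ∈ Finset.univ) => hterm i j
  simp only [Finset.sum_add_distrib] at this
  linarith

/-- A lower bound of Cramér–Rao type by a single off-diagonal entry. -/
theorem norm_sq_mul_le_qfi_diagonal (hρ : IsState ρ) (w : n → ℂ) (x y : n) :
    ‖ρ x y‖ ^ 2 * ‖w y - w x‖ ^ 2 ≤ qfi ρ (Matrix.diagonal w) := by
  have hh := hρ.1.isHermitian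
  have h0 := hρ.1.eigenvalues_nonneg
  have hsum := hρ.sum_eigenvalues
  have hU := hh.eigenvectorUnitary_mul_conjTranspose
  have hcomm := hh.conj_commutator_apply (Matrix.diagonal w)
  rw [qfi_eq hh]
  set U := (hh.eigenvectorUnitary : Matrix n n ℂ) with hUdef
  set l := hh.eigenvalues with hl
  set G := Uᴴ * Matrix.diagonal w * U with hG
  set C := ρ * Matrix.diagonal w - Matrix.diagonal w * ρ with hC
  have hCxy : C x y = ρ x y * (w y - w x) := by
    rw [hC, Matrix.sub_apply, Matrix.mul_diagonal, Matrix.diagonal_mul]; ring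
  have hCU : C = U * (Uᴴ * C * U) * Uᴴ := by
    calc C = (U * Uᴴ) * C * (U * Uᴴ) := by rw [hU, Matrix.one_mul, Matrix.mul_one]
      _ = _ := by simp only [Matrix.mul_assoc]
  have hexp : C x y = ∑ j, ∑ i, U x i * (((l i : ℂ) - l j) * G i j) * star (U y j) := by
    conv_lhs => rw [hCU]
    simp only [Matrix.mul_apply (M := U * (Uᴴ * C * U)), Matrix.mul_apply (M := U),
      Matrix.conjTranspose_apply, hcomm, Finset.sum_mul]
  have hle1 : ∀ i, l i ≤ 1 := fun i => by
    rw [← hsum]; exact Finset.single_le_sum (fun j _ => h0 j) (Finset.mem_univ i)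
  -- Cauchy–Schwarz with weight `λᵢ + λⱼ`: the first factor is half the QFI and the second is at
  -- most `2`, so the constants cancel. Where the weight vanishes, both eigenvalues do, and the
  -- left-hand term is zero as well.
  have hCS : (∑ p : n × n, ‖U x p.1‖ * (|l p.1 - l p.2| * ‖G p.1 p.2‖) * ‖U y p.2‖) ^ 2 ≤
      (∑ p : n × n, (l p.1 - l p.2) ^ 2 / (l p.1 + l p.2) * ‖G p.1 p.2‖ ^ 2) *
        ∑ p : n × n, (l p.1 + l p.2) * (‖U x p.1‖ ^ 2 * ‖U y p.2‖ ^ 2) := by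
    apply Finset.sum_sq_le_sum_mul_sum_of_sq_le_mul
    · rintro ⟨i, j⟩ -
      have := h0 i; have := h0 j
      positivity
    · rintro ⟨i, j⟩ -
      have := h0 i; have := h0 j
      positivity
    · rintro ⟨i, j⟩ -
      have hi : 0 ≤ l i := h0 i
      have hj : 0 ≤ l j := h0 j
      simp only [mul_pow, sq_abs]
      rcases (add_nonneg hi hj).eq_or_lt with h | h
      · have h1 : l i = 0 := by linarith
        have h2 : l j = 0 := by linarith
        simp [h1, h2]
      · apply le_of_eq
        field_simp
  have hsecond : ∑ p : n × n, (l p.1 + l p.2) * (‖U x p.1‖ ^ 2 * ‖U y p.2‖ ^ 2) ≤ 2 := by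
    calc _ ≤ ∑ p : n × n, 2 * (‖U x p.1‖ ^ 2 * ‖U y p.2‖ ^ 2) := by
          gcongr with p
          linarith [hle1 p.1, hle1 p.2]
      _ = 2 := by
          rw [← Finset.mul_sum, Fintype.sum_prod_type'
            (f := fun i j => ‖U x i‖ ^ 2 * ‖U y j‖ ^ 2), ← Finset.sum_mul_sum,
            sum_norm_sq_row U hU, sum_norm_sq_row U hU]
          norm_num
  have hnorm : ‖C x y‖ ≤ ∑ p : n × n, ‖U x p.1‖ * (|l p.1 - l p.2| * ‖G p.1 p.2‖) * ‖U y p.2‖ := by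
    rw [hexp, Finset.sum_comm, ← Fintype.sum_prod_type'
      (f := fun i j => U x i * (((l i : ℂ) - l j) * G i j) * star (U y j))]
    refine (norm_sum_le _ _).trans (le_of_eq (Finset.sum_congr rfl fun p _ => ?_))
    rw [norm_mul, norm_mul, norm_mul, norm_star, ← Complex.ofReal_sub, Complex.norm_real,
      Real.norm_eq_abs]
  have hF : 0 ≤ ∑ p : n × n, (l p.1 - l p.2) ^ 2 / (l p.1 + l p.2) * ‖G p.1 p.2‖ ^ 2 := by
    refine Finset.sum_nonneg fun p _ => ?_
    have := h0 p.1; have := h0 p.2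
    positivity
  rw [← mul_pow, ← norm_mul, ← hCxy, ← Fintype.sum_prod_type'
    (f := fun i j => (l i - l j) ^ 2 / (l i + l j) * ‖G i j‖ ^ 2)]
  calc ‖C x y‖ ^ 2 ≤ _ := pow_le_pow_left₀ (norm_nonneg _) hnorm 2
    _ ≤ _ := hCS
    _ ≤ _ := mul_le_mul_of_nonneg_left hsecond hF
    _ = _ := mul_comm _ _

end QFI

section Ketbra

theorem isState_ketbra {m : Type*} [Fintype m] {ψ : m → ℂ} (hψ : ∑ s, ‖ψ s‖ ^ 2 = 1) : IsState (ketbra ψ) := by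
  refine ⟨Matrix.posSemidef_vecMulVec_self_star ψ, ?_⟩
  simp only [ketbra, Matrix.trace, Matrix.diag_apply, Matrix.vecMulVec_apply, Pi.star_apply,
    RCLike.star_def, Complex.mul_conj']
  exact_mod_cast hψ

theorem sum_norm_sq_single {m : Type*} [Fintype m] [DecidableEq m] (s : m) : ∑ t, ‖(Pi.single s 1 : m → ℂ) t‖ ^ 2 = 1 := by
  rw [Finset.sum_eq_single s] <;> simp +contextual

theorem ketbra_single {m : Type*} [DecidableEq m] (s : m) :
    ketbra (Pi.single s (1 : ℂ)) = Matrix.diagonal (Pi.single s 1) := by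
  ext x y
  simp only [ketbra, Matrix.vecMulVec_apply, Pi.star_apply, Matrix.diagonal_apply, Pi.single_apply]
  by_cases h1 : x = s <;> by_cases h2 : y = s <;> simp [h1, h2]
  intro h; exact absurd h.symm h2

theorem isIncoherent_ketbra_single {m : Type*} [Fintype m] [DecidableEq m] (s : m) :
    IsIncoherent (ketbra (Pi.single s (1 : ℂ))) := by
  refine ⟨isState_ketbra (sum_norm_sq_single s), ?_⟩
  rw [ketbra_single]
  exact Matrix.isDiag_diagonal _

end Ketbra

/-! ### Incoherent operations -/

section Operations

variable {m n : Type*} [Fintype m] [Fintype n] [DecidableEq m]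

theorem IsKrausFamily.isState {r : ℕ} {K : Fin r → Matrix n m ℂ}
    {Φ : Matrix m m ℂ →ₗ[ℂ] Matrix n n ℂ} (hK : IsKrausFamily K Φ) {σ : Matrix m m ℂ}
    (hσ : IsState σ) : IsState (Φ σ) := by
  rw [hK.2]
  refine ⟨Matrix.posSemidef_sum _ fun k _ => hσ.1.mul_mul_conjTranspose_same (K k), ?_⟩
  calc (∑ k, K k * σ * (K k)ᴴ).trace = ((∑ k, (K k)ᴴ * K k) * σ).trace := by
        rw [Matrix.trace_sum, Finset.sum_mul, Matrix.trace_sum]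
        refine Finset.sum_congr rfl fun k _ => ?_
        rw [Matrix.trace_mul_comm, Matrix.mul_assoc]
    _ = 1 := by rw [hK.1, Matrix.one_mul, hσ.2]

theorem IsICPTP.isState {c : IncoherentOpClass} {Φ : Matrix m m ℂ →ₗ[ℂ] Matrix n n ℂ}
    (hΦ : IsICPTP c Φ) {σ : Matrix m m ℂ} (hσ : IsState σ) : IsState (Φ σ) := by
  cases c with
  | preserving =>
    obtain ⟨⟨r, K, hK⟩, -⟩ := hΦ
    exact hK.isState hσ
  | kraus =>
    obtain ⟨r, K, hK, -⟩ := hΦ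
    exact hK.isState hσ

theorem Matrix.IsDiag.sum {ι α : Type*} {A : ι → Matrix α α ℂ} {s : Finset ι}
    (hA : ∀ i, (A i).IsDiag) : (∑ i ∈ s, A i).IsDiag := by
  intro x y hxy
  rw [Matrix.sum_apply]
  exact Finset.sum_eq_zero fun i _ => hA i hxy

theorem IsICPTP.isIncoherent {c : IncoherentOpClass} {Φ : Matrix m m ℂ →ₗ[ℂ] Matrix n n ℂ}
    (hΦ : IsICPTP c Φ) {σ : Matrix m m ℂ} (hσ : IsIncoherent σ) : IsIncoherent (Φ σ) := by
  cases c with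
  | preserving => exact hΦ.2 σ hσ
  | kraus =>
    refine ⟨hΦ.isState hσ.1, ?_⟩
    obtain ⟨r, K, hK, hd⟩ := hΦ
    rw [hK.2]
    exact Matrix.IsDiag.sum fun k => hd k σ hσ

/-- The Kraus condition implies preservation of incoherent states, so one construction serves both
readings. -/
theorem IsICPTP.of_kraus {c : IncoherentOpClass} {Φ : Matrix m m ℂ →ₗ[ℂ] Matrix n n ℂ} {r : ℕ}
    {K : Fin r → Matrix n m ℂ} (hK : IsKrausFamily K Φ)
    (hd : ∀ k (σ : Matrix m m ℂ), IsIncoherent σ → (K k * σ * (K k)ᴴ).IsDiag) : IsICPTP c Φ := by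
  have h : IsICPTP .kraus Φ := ⟨r, K, hK, hd⟩
  cases c with
  | preserving => exact ⟨⟨r, K, hK⟩, fun σ hσ => h.isIncoherent hσ⟩
  | kraus => exact h

variable [DecidableEq n]

/-- The operator `∑ |f u⟩⟨u|` over those basis labels `u` with `g u = k`. -/
noncomputable def labelKraus {r : ℕ} (f : m → n) (g : m → Fin r) (k : Fin r) : Matrix n m ℂ :=
  Matrix.of fun z u => if g u = k ∧ f u = z then 1 else 0

theorem labelKraus_conj_apply {m n : Type*} [Fintype m] [DecidableEq n] {r : ℕ} (f : m → n) (g : m → Fin r) (k : Fin r) (X : Matrix m m ℂ)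
    (z w : n) : (labelKraus f g k * X * (labelKraus f g k)ᴴ) z w =
      ∑ v, ∑ u, if (g u = k ∧ f u = z) ∧ (g v = k ∧ f v = w) then X u v else 0 := by
  rw [Matrix.mul_apply]
  refine Finset.sum_congr rfl fun v _ => ?_
  rw [Matrix.mul_apply, Finset.sum_mul]
  refine Finset.sum_congr rfl fun u _ => ?_
  simp only [labelKraus, Matrix.of_apply, Matrix.conjTranspose_apply]
  by_cases h1 : g u = k ∧ f u = z <;> by_cases h2 : g v = k ∧ f v = w <;> simp [h1, h2]

/-- The operation with Kraus operators `labelKraus f g k`. -/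
noncomputable def labelOp {r : ℕ} (f : m → n) (g : m → Fin r) :
    Matrix m m ℂ →ₗ[ℂ] Matrix n n ℂ where
  toFun X := ∑ k, labelKraus f g k * X * (labelKraus f g k)ᴴ
  map_add' X Y := by simp only [Matrix.mul_add, Matrix.add_mul, Finset.sum_add_distrib]
  map_smul' a X := by simp [Finset.smul_sum]

/-- Injectivity of `u ↦ (f u, g u)` gives trace preservation. Each Kraus operator sends a basis
vector to a basis vector or to zero, hence creates no off-diagonal entries from a diagonal state. -/
theorem isICPTP_labelOp (c : IncoherentOpClass) {r : ℕ} {f : m → n} {g : m → Fin r}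
    (hfg : ∀ u v, f u = f v → g u = g v → u = v) : IsICPTP c (labelOp f g) := by
  refine IsICPTP.of_kraus (K := labelKraus f g) ⟨?_, fun X => rfl⟩ ?_
  · ext u v
    rw [Matrix.sum_apply]
    simp only [Matrix.mul_apply, labelKraus, Matrix.of_apply, Matrix.conjTranspose_apply]
    rw [Finset.sum_eq_single (g u) (by intro k _ hk; simp [hk.symm]) (by simp),
      Finset.sum_eq_single (f u) (by intro z _ hz; simp [hz.symm]) (by simp)]
    by_cases huv : u = v
    · subst huv; simp
    · have : ¬ (g v = g u ∧ f v = f u) := fun h => huv (hfg u v h.2.symm h.1.symm)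
      simp [huv, this]
  · intro k σ hσ z w hzw
    rw [labelKraus_conj_apply]
    refine Finset.sum_eq_zero fun v _ => Finset.sum_eq_zero fun u _ => ?_
    split_ifs with h
    · refine hσ.2 fun huv => hzw ?_
      rw [← h.1.2, ← h.2.2, huv]
    · rfl

/-- Some incoherent operation moves a given off-diagonal entry to any given position. -/
theorem exists_isICPTP_apply_eq (c : IncoherentOpClass) {s t : m} (hst : s ≠ t) {x y : n}
    (hxy : x ≠ y) : ∃ Φ : Matrix m m ℂ →ₗ[ℂ] Matrix n n ℂ, IsICPTP c Φ ∧ ∀ X, Φ X x y = X s t := by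
  let e := Fintype.equivFin m
  -- The Kraus operator labelled `e s` is `|x⟩⟨s| + |y⟩⟨t|`, which transports the entry at `(s, t)`.
  -- Every other basis label is sent to `x` by a Kraus operator of its own and contributes nothing
  -- at `(x, y)`.
  let f : m → n := fun u => if u = t then y else x
  let g : m → Fin (Fintype.card m) := fun u => if u = t then e s else e u
  refine ⟨labelOp f g, isICPTP_labelOp c ?_, fun X => ?_⟩
  · intro u v hf hg
    by_cases hu : u = t <;> by_cases hv : v = t <;> simp_all [f, g, eq_comm]
  · have hf : ∀ u, f u = y ↔ u = t := fun u => by by_cases hu : u = t <;> simp [f, hu, hxy]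
    have hf' : ∀ u, f u = x ↔ u ≠ t := fun u => by by_cases hu : u = t <;> simp [f, hu, hxy.symm]
    have hgt : g t = e s := by simp [g]
    change (∑ k, labelKraus f g k * X * (labelKraus f g k)ᴴ) x y = X s t
    rw [Matrix.sum_apply]
    simp only [labelKraus_conj_apply, hf, hf']
    rw [Finset.sum_eq_single (e s), Finset.sum_eq_single t, Finset.sum_eq_single s]
    · simp [g, hst]
    · intro u _ hu
      by_cases hut : u = t
      · simp [hut]
      · simp [g, hut, hu]
    · simp
    · intro v _ hv; simp [hv]
    · simp
    · intro k _ hk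
      refine Finset.sum_eq_zero fun v _ => Finset.sum_eq_zero fun u _ => if_neg ?_
      rintro ⟨-, h1, rfl⟩
      exact hk (h1.symm.trans hgt)
    · simp

end Operations

/-! ### Energies of the signal Hamiltonian -/

section Hamiltonian

variable {d : ℕ → ℕ} {h : (i : ℕ) → Matrix (Fin (d i)) (Fin (d i)) ℂ}

theorem signalHamiltonian_kronecker_one (h_diag : ∀ i, (h i).IsDiag) (N a : ℕ) :
    signalHamiltonian h N ⊗ₖ (1 : Matrix (Fin a) (Fin a) ℂ) =
      Matrix.diagonal fun p : Config d N × Fin a => ∑ i : Fin N, h i (p.1 i) (p.1 i) := by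
  have h1 : signalHamiltonian h N =
      Matrix.diagonal fun x : Config d N => ∑ i : Fin N, h i (x i) (x i) := by
    ext x y
    rw [signalHamiltonian, Matrix.sum_apply]
    by_cases hxy : x = y
    · subst hxy; simp [localOp]
    · rw [Matrix.diagonal_apply_ne _ hxy]
      refine Finset.sum_eq_zero fun i _ => ?_
      simp only [localOp, Matrix.of_apply]
      split_ifs with hj
      · refine h_diag i fun hi => hxy (funext fun j => ?_)
        by_cases hji : j = i
        · subst hji; exact hi
        · exact hj j hji
      · rfl
  rw [h1, ← Matrix.diagonal_one, Matrix.diagonal_kronecker_diagonal]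
  simp

theorem dist_le_spectralSpread {n : Type*} [Fintype n] [DecidableEq n] {A : Matrix n n ℂ}
    (hA : A.IsDiag) (x y : n) : dist (A x x) (A y y) ≤ spectralSpread A := by
  rw [← hA.diagonal_diag, spectralSpread, spectrum_diagonal]
  refine Metric.dist_le_diam_of_mem (Set.finite_range _).isBounded ⟨x, ?_⟩ ⟨y, ?_⟩ <;> simp

/-- If all energy gaps were below half the spread, the diameter would be at most half of itself. The
lost factor `2` does not affect the growth exponent. -/
theorem exists_half_spectralSpread_le {n : Type*} [Fintype n] [DecidableEq n] {A : Matrix n n ℂ}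
    (hA : A.IsDiag) (hA' : A.IsHermitian) (hpos : 0 < spectralSpread A) :
    ∃ x y, spectralSpread A / 2 ≤ (A y y).re - (A x x).re := by
  have him : ∀ x, (A x x).im = 0 := fun x => Complex.conj_eq_iff_im.1 (hA'.apply x x)
  have hdist : ∀ x y, dist (A x x) (A y y) = |(A x x).re - (A y y).re| := fun x y => by
    rw [dist_eq_norm, Complex.norm_def, Complex.normSq_apply]
    simp [him, ← Real.sqrt_sq_eq_abs, sq]
  by_contra! hcon
  have hle : spectralSpread A ≤ spectralSpread A / 2 := by
    conv_lhs => rw [← hA.diagonal_diag, spectralSpread, spectrum_diagonal]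
    refine Metric.diam_le_of_forall_dist_le (by positivity) ?_
    rintro _ ⟨x, rfl⟩ _ ⟨y, rfl⟩
    rw [Matrix.diag_apply, Matrix.diag_apply, hdist, abs_le]
    constructor <;> linarith [hcon x y, hcon y x]
  linarith

end Hamiltonian

/-! ### Quadratic bounds on the QFI coherence -/

section Coherence

variable {S : Type*} [Fintype S] [DecidableEq S] {d : ℕ → ℕ}
  {h : (i : ℕ) → Matrix (Fin (d i)) (Fin (d i)) ℂ}

theorem qfiCoherencePure_le (c : IncoherentOpClass) (h_diag : ∀ i, (h i).IsDiag)
    (hd : ∀ i, Nonempty (Fin (d i))) {M : ℝ} (hM : ∀ i, spectralSpread (h i) ≤ M) (N : ℕ)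
    {ψ : S → ℂ} (hψ : ∑ s, ‖ψ s‖ ^ 2 = 1) :
    qfiCoherencePure c h N ψ ≤ ENNReal.ofReal (4 * (N * M) ^ 2) := by
  refine iSup_le fun a => iSup_le fun Φ => iSup_le fun hΦ => ENNReal.ofReal_le_ofReal ?_
  rw [signalHamiltonian_kronecker_one h_diag]
  -- The energy of an arbitrary reference configuration serves as the centre; each particle deviates
  -- from it by at most `M`.
  let x : (i : ℕ) → Fin (d i) := fun i => (hd i).some
  refine qfi_diagonal_le (hΦ.isState (isState_ketbra hψ)) (∑ i : Fin N, h i (x i) (x i)) fun p => ?_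
  rw [← Finset.sum_sub_distrib]
  calc _ ≤ ∑ i : Fin N, M := by
        refine (norm_sum_le _ _).trans (Finset.sum_le_sum fun i _ => ?_)
        rw [← dist_eq_norm]
        exact (dist_le_spectralSpread (h_diag i) _ _).trans (hM i)
    _ = N * M := by simp

theorem qfiCoherencePure_single_eq_zero (c : IncoherentOpClass) (h_diag : ∀ i, (h i).IsDiag)
    (N : ℕ) (s : S) : qfiCoherencePure c h N (Pi.single s (1 : ℂ)) = 0 := by
  refine le_antisymm ?_ zero_le
  refine iSup_le fun a => iSup_le fun Φ => iSup_le fun hΦ => ?_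
  have hi := hΦ.isIncoherent (isIncoherent_ketbra_single s)
  rw [signalHamiltonian_kronecker_one h_diag, qfi_eq_zero_of_commute hi.1.1.isHermitian,
    ENNReal.ofReal_zero]
  rw [← hi.2.diagonal_diag, Matrix.diagonal_mul_diagonal, Matrix.diagonal_mul_diagonal]
  simp only [mul_comm]

theorem le_qfiCoherencePure (c : IncoherentOpClass) (h_herm : ∀ i, (h i).IsHermitian)
    (h_diag : ∀ i, (h i).IsDiag) {m : ℝ} (hm : 0 < m) (hm' : ∀ i, m ≤ spectralSpread (h i))
    {N : ℕ} (hN : N ≠ 0) {ψ : S → ℂ} (hψ : ∑ s, ‖ψ s‖ ^ 2 = 1) {s t : S} (hst : s ≠ t) :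
    ENNReal.ofReal ((‖ψ s‖ * ‖ψ t‖) ^ 2 * (N * (m / 2)) ^ 2) ≤ qfiCoherencePure c h N ψ := by
  choose x y hxy using fun i =>
    exists_half_spectralSpread_le (h_diag i) (h_herm i) (hm.trans_le (hm' i))
  -- All particles are taken low in `X` and high in `Y`, so the single-particle gaps add up. A
  -- one-dimensional ancilla suffices.
  let X : Config d N × Fin 1 := (fun i => x i, 0)
  let Y : Config d N × Fin 1 := (fun i => y i, 0)
  let w : Config d N × Fin 1 → ℂ := fun p => ∑ i : Fin N, h i (p.1 i) (p.1 i)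
  have hw : N * (m / 2) ≤ ‖w Y - w X‖ := by
    refine le_trans ?_ ((le_abs_self _).trans (Complex.abs_re_le_norm _))
    rw [Complex.sub_re, Complex.re_sum, Complex.re_sum, ← Finset.sum_sub_distrib]
    calc (N : ℝ) * (m / 2) = ∑ i : Fin N, m / 2 := by simp
      _ ≤ _ := Finset.sum_le_sum fun i _ => by
          have h1 := hxy i
          have h2 := hm' i
          simp only [X, Y]
          linarith
  have hpos : 0 < N * (m / 2) := by positivity
  have hne : X ≠ Y := by
    intro he
    rw [he, sub_self, norm_zero] at hw
    linarith
  obtain ⟨Φ, hΦ, hval⟩ := exists_isICPTP_apply_eq c hst hne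
  refine le_trans ?_ (le_iSup_of_le 1 (le_iSup_of_le Φ (le_iSup_of_le hΦ le_rfl)))
  refine ENNReal.ofReal_le_ofReal ?_
  rw [signalHamiltonian_kronecker_one h_diag]
  refine le_trans ?_ (norm_sq_mul_le_qfi_diagonal (hΦ.isState (isState_ketbra hψ)) w X Y)
  rw [hval]
  have hk : ‖ketbra ψ s t‖ = ‖ψ s‖ * ‖ψ t‖ := by simp [ketbra, Matrix.vecMulVec_apply]
  rw [hk]
  gcongr

/-- The entry of `ρ` is at most the `p`-average of the products `‖ψ k s‖ * ‖ψ k t‖`. Its square is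
at most the average of the squares, which the pure-state bound controls for every decomposition at
once. -/
theorem le_qfiCoherence (c : IncoherentOpClass) (h_herm : ∀ i, (h i).IsHermitian)
    (h_diag : ∀ i, (h i).IsDiag) {m : ℝ} (hm : 0 < m) (hm' : ∀ i, m ≤ spectralSpread (h i))
    {N : ℕ} (hN : N ≠ 0) (ρ : Matrix S S ℂ) {s t : S} (hst : s ≠ t) :
    ENNReal.ofReal (‖ρ s t‖ ^ 2 * (N * (m / 2)) ^ 2) ≤ qfiCoherence c h N ρ := by
  refine le_iInf fun r => le_iInf fun p => le_iInf fun ψ => le_iInf fun hdec => ?_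
  obtain ⟨hp, hψ, hρ⟩ := hdec
  set a : Fin r → ℝ := fun k => ‖ψ k s‖ * ‖ψ k t‖ with ha
  have hp' : ∑ k, (p k : ℝ) = 1 := by exact_mod_cast hp
  have hle : ‖ρ s t‖ ≤ ∑ k, (p k : ℝ) * a k := by
    rw [hρ, Matrix.sum_apply]
    refine (norm_sum_le _ _).trans (le_of_eq (Finset.sum_congr rfl fun k _ => ?_))
    simp [ketbra, Matrix.vecMulVec_apply, ha]
  have hsq : (∑ k, (p k : ℝ) * a k) ^ 2 ≤ ∑ k, (p k : ℝ) * a k ^ 2 := by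
    have := Finset.sum_sq_le_sum_mul_sum_of_sq_le_mul Finset.univ
      (r := fun k => (p k : ℝ) * a k) (f := fun k => (p k : ℝ)) (g := fun k => (p k : ℝ) * a k ^ 2)
      (fun k _ => by positivity) (fun k _ => by positivity) (fun k _ => le_of_eq (by ring))
    rwa [hp', one_mul] at this
  calc ENNReal.ofReal (‖ρ s t‖ ^ 2 * (N * (m / 2)) ^ 2)
      ≤ ENNReal.ofReal (∑ k, (p k : ℝ) * (a k ^ 2 * (N * (m / 2)) ^ 2)) := by
        refine ENNReal.ofReal_le_ofReal ?_
        simp only [← mul_assoc]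
        rw [← Finset.sum_mul]
        gcongr
        exact (pow_le_pow_left₀ (norm_nonneg _) hle 2).trans hsq
    _ = ∑ k, (p k : ℝ≥0∞) * ENNReal.ofReal (a k ^ 2 * (N * (m / 2)) ^ 2) := by
        rw [ENNReal.ofReal_sum_of_nonneg fun k _ => by positivity]
        refine Finset.sum_congr rfl fun k _ => ?_
        rw [ENNReal.ofReal_mul (p k).coe_nonneg, ENNReal.ofReal_coe_nnreal]
    _ ≤ _ := by
        gcongr with k
        exact le_qfiCoherencePure c h_herm h_diag hm hm' hN (hψ k) hst

theorem qfiCoherence_le_of_isPureDecomposition (c : IncoherentOpClass) (N : ℕ) {ρ : Matrix S S ℂ}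
    {r : ℕ} {p : Fin r → ℝ≥0} {ψ : Fin r → S → ℂ} (hdec : IsPureDecomposition ρ p ψ) {b : ℝ≥0∞}
    (hb : ∀ k, qfiCoherencePure c h N (ψ k) ≤ b) : qfiCoherence c h N ρ ≤ b := by
  calc qfiCoherence c h N ρ ≤ ∑ k, (p k : ℝ≥0∞) * qfiCoherencePure c h N (ψ k) :=
        iInf_le_of_le r (iInf_le_of_le p (iInf_le_of_le ψ (iInf_le_of_le hdec le_rfl)))
    _ ≤ ∑ k, (p k : ℝ≥0∞) * b := by gcongr with k; exact hb k
    _ = b := by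
      rw [← Finset.sum_mul, ← ENNReal.ofNNReal_finsetSum, hdec.1, ENNReal.coe_one, one_mul]

/-- An ensemble of unit vectors indexed by the basis labels gives a pure-state decomposition. -/
theorem exists_isPureDecomposition {S : Type*} [Fintype S] {ρ : Matrix S S ℂ} {l : S → ℝ}
    {v : S → S → ℂ} (hl0 : ∀ s, 0 ≤ l s) (hl : ∑ s, l s = 1) (hv : ∀ s, ∑ t, ‖v s t‖ ^ 2 = 1)
    (hρ : ρ = ∑ s, (l s : ℂ) • ketbra (v s)) :
    ∃ p, IsPureDecomposition ρ p fun k => v ((Fintype.equivFin S).symm k) := by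
  refine ⟨fun k => (l ((Fintype.equivFin S).symm k)).toNNReal, ?_, fun k => hv _, ?_⟩
  · rw [Equiv.sum_comp (Fintype.equivFin S).symm fun s => (l s).toNNReal,
      ← Real.toNNReal_sum_of_nonneg fun s _ => hl0 s, hl, Real.toNNReal_one]
  · simp only [Real.coe_toNNReal _ (hl0 _)]
    rw [hρ]
    exact (Equiv.sum_comp (Fintype.equivFin S).symm fun s => (l s : ℂ) • ketbra (v s)).symm

/-- The spectral decomposition is one admissible ensemble, and the pure-state bound is uniform over
unit vectors. -/
theorem qfiCoherence_le (c : IncoherentOpClass) (h_diag : ∀ i, (h i).IsDiag)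
    (hd : ∀ i, Nonempty (Fin (d i))) {M : ℝ} (hM : ∀ i, spectralSpread (h i) ≤ M) (N : ℕ)
    {ρ : Matrix S S ℂ} (hρ : IsState ρ) :
    qfiCoherence c h N ρ ≤ ENNReal.ofReal (4 * (N * M) ^ 2) := by
  have hh := hρ.1.isHermitian
  have hcol := sum_norm_sq_col (hh.eigenvectorUnitary : Matrix S S ℂ)
    hh.conjTranspose_eigenvectorUnitary_mul
  obtain ⟨p, hdec⟩ := exists_isPureDecomposition (ρ := ρ) hρ.1.eigenvalues_nonneg
    hρ.sum_eigenvalues (v := fun s t => (hh.eigenvectorUnitary : Matrix S S ℂ) t s) hcol (by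
      conv_lhs => rw [hh.eq_conj_diagonal]
      ext x y
      rw [Matrix.mul_apply, Matrix.sum_apply]
      refine Finset.sum_congr rfl fun s _ => ?_
      rw [Matrix.mul_diagonal, Matrix.conjTranspose_apply, Matrix.smul_apply, ketbra,
        Matrix.vecMulVec_apply, Pi.star_apply, smul_eq_mul]
      ring)
  exact qfiCoherence_le_of_isPureDecomposition c N hdec
    fun k => qfiCoherencePure_le c h_diag hd hM N (hcol _)

theorem qfiCoherence_eq_zero (c : IncoherentOpClass) (h_diag : ∀ i, (h i).IsDiag) (N : ℕ)
    {ρ : Matrix S S ℂ} (hρ : IsIncoherent ρ) : qfiCoherence c h N ρ = 0 := by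
  have hnn : ∀ s, 0 ≤ ρ s s := fun s => hρ.1.1.diag_nonneg
  have hre : ∀ s, (((ρ s s).re : ℝ) : ℂ) = ρ s s := fun s =>
    (Complex.eq_re_of_ofReal_le (hnn s)).symm
  obtain ⟨p, hdec⟩ := exists_isPureDecomposition (ρ := ρ) (l := fun s => (ρ s s).re)
    (v := fun s => Pi.single s 1) (fun s => (Complex.le_def.1 (hnn s)).1)
    (by simpa [Matrix.trace] using congrArg Complex.re hρ.1.2) sum_norm_sq_single (by
      simp only [hre, ketbra_single]
      ext x y
      rw [Matrix.sum_apply]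
      by_cases hxy : x = y
      · subst hxy
        simp [Pi.single_apply]
      · simp [hρ.2 hxy, hxy])
  exact le_antisymm (qfiCoherence_le_of_isPureDecomposition c N hdec
    fun k => (qfiCoherencePure_single_eq_zero c h_diag N _).le) zero_le

end Coherence

/-! ### Logarithmic growth rates -/

section Asymptotics

/-- A sequence growing like `N ^ 2` up to constants has logarithmic growth rate `2`. -/
theorem tendsto_log_div_log_of_quadratic_bounds {f : ℕ → ℝ≥0∞} {A B : ℝ} (hA : 0 < A)
    (hlow : ∀ N : ℕ, N ≠ 0 → ENNReal.ofReal (A * N ^ 2) ≤ f N)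
    (hup : ∀ N : ℕ, f N ≤ ENNReal.ofReal (B * N ^ 2)) :
    Tendsto (fun N : ℕ => ENNReal.log (f N) / ENNReal.log (N : ℝ≥0∞)) atTop (𝓝 2) := by
  have htop : ∀ N, f N ≠ ⊤ := fun N => ((hup N).trans_lt ENNReal.ofReal_lt_top).ne
  have hlow' : ∀ N : ℕ, N ≠ 0 → A * N ^ 2 ≤ (f N).toReal := fun N hN =>
    (ENNReal.ofReal_le_iff_le_toReal (htop N)).1 (hlow N hN)
  -- Comparing the two bounds at `N = 1` forces the upper constant to be positive.
  have hB : 0 < B := by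
    have h1 := (hlow 1 one_ne_zero).trans (hup 1)
    have h2 : 0 < ENNReal.ofReal (B * ((1 : ℕ) : ℝ) ^ 2) :=
      (ENNReal.ofReal_pos.2 (by simpa using hA)).trans_le h1
    simpa using ENNReal.ofReal_pos.1 h2
  have hup' : ∀ N : ℕ, (f N).toReal ≤ B * N ^ 2 := fun N =>
    ENNReal.toReal_le_of_le_ofReal (by positivity) (hup N)
  have hlogN : Tendsto (fun N : ℕ => Real.log N) atTop atTop :=
    Real.tendsto_log_atTop.comp tendsto_natCast_atTop_atTop
  have hconst : ∀ a : ℝ, Tendsto (fun N : ℕ => a / Real.log N + 2) atTop (𝓝 2) := fun a => by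
    simpa using (hlogN.const_div_atTop a).add_const 2
  have hsplit : ∀ a : ℝ, 0 < a → ∀ N : ℕ, 2 ≤ N →
      a.log / Real.log N + 2 = Real.log (a * N ^ 2) / Real.log N := fun a ha N hN => by
    have hN0 : (N : ℝ) ≠ 0 := by positivity
    have hlN : Real.log N ≠ 0 := (Real.log_pos (by exact_mod_cast hN)).ne'
    rw [Real.log_mul ha.ne' (by positivity), Real.log_pow]
    field_simp
    norm_num
  have hreal : Tendsto (fun N : ℕ => Real.log (f N).toReal / Real.log N) atTop (𝓝 2) := by
    refine tendsto_of_tendsto_of_tendsto_of_le_of_le' (hconst (Real.log A)) (hconst (Real.log B))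
      ?_ ?_
    · filter_upwards [eventually_ge_atTop 2] with N hN
      have hlN : 0 < Real.log N := Real.log_pos (by exact_mod_cast hN)
      rw [hsplit A hA N hN]
      have : (N : ℝ) ≠ 0 := by positivity
      gcongr
      exact hlow' N (by positivity)
    · filter_upwards [eventually_ge_atTop 2] with N hN
      have hlN : 0 < Real.log N := Real.log_pos (by exact_mod_cast hN)
      rw [hsplit B hB N hN]
      -- The lower bound makes `(f N).toReal` positive, as monotonicity of the logarithm requires.
      have : 0 < A * (N : ℝ) ^ 2 := by positivity
      have := this.trans_le (hlow' N (by positivity))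
      gcongr
      exact hup' N
  have hE : Tendsto (fun N : ℕ => ((Real.log (f N).toReal / Real.log N : ℝ) : EReal)) atTop
      (𝓝 ((2 : ℝ) : EReal)) := (continuous_coe_real_ereal.tendsto 2).comp hreal
  refine hE.congr' ?_
  filter_upwards [eventually_ge_atTop 2] with N hN
  have hpos : 0 < A * (N : ℝ) ^ 2 := by positivity
  have hf0 : f N ≠ 0 := fun h0 => by
    have := hlow' N (by positivity)
    rw [h0, ENNReal.toReal_zero] at this
    linarith
  rw [EReal.coe_div, ENNReal.log_pos_real hf0 (htop N),
    ENNReal.log_pos_real (by simp; omega) (ENNReal.natCast_ne_top N), ENNReal.toReal_natCast]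

end Asymptotics

/-! ### The two values of the asymptotic QFI coherence -/

section Asymptotic

variable {S : Type*} [Fintype S] [DecidableEq S] {d : ℕ → ℕ} {c : IncoherentOpClass}
  {h : (i : ℕ) → Matrix (Fin (d i)) (Fin (d i)) ℂ} {ρ : Matrix S S ℂ}

theorem tendsto_qfiLogRatio_of_isIncoherent (h_diag : ∀ i, (h i).IsDiag) (hρ : IsIncoherent ρ) :
    Tendsto (qfiLogRatio c h ρ) atTop (𝓝 ⊥) := by
  refine tendsto_const_nhds.congr' ?_
  -- For `N ≥ 2` the denominator `log N` is positive and finite, so the quotient of `⊥` by it is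
  -- `⊥`.
  filter_upwards [eventually_ge_atTop 2] with N hN
  rw [qfiLogRatio, qfiCoherence_eq_zero c h_diag N hρ, ENNReal.log_zero,
    EReal.bot_div_of_pos_ne_top]
  · rw [ENNReal.zero_lt_log_iff]
    exact_mod_cast hN
  · rw [ne_eq, ENNReal.log_eq_top_iff]
    exact ENNReal.natCast_ne_top N

theorem tendsto_qfiLogRatio_of_isCoherent (h_herm : ∀ i, (h i).IsHermitian)
    (h_diag : ∀ i, (h i).IsDiag) {m M : ℝ} (hm : 0 < m) (hm' : ∀ i, m ≤ spectralSpread (h i))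
    (hM : ∀ i, spectralSpread (h i) ≤ M) (hρ : IsCoherent ρ) :
    Tendsto (qfiLogRatio c h ρ) atTop (𝓝 2) := by
  have hnd : ¬ ρ.IsDiag := fun hd => hρ.2 ⟨hρ.1, hd⟩
  simp only [Matrix.IsDiag, Pairwise] at hnd
  push Not at hnd
  obtain ⟨s, t, hst, hne⟩ := hnd
  -- A positive spread already supplies a basis label for each particle.
  have hd : ∀ i, Nonempty (Fin (d i)) := fun i =>
    ⟨(exists_half_spectralSpread_le (h_diag i) (h_herm i) (hm.trans_le (hm' i))).choose⟩
  have hne' : 0 < ‖ρ s t‖ := norm_pos_iff.2 hne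
  refine tendsto_log_div_log_of_quadratic_bounds (A := ‖ρ s t‖ ^ 2 * (m / 2) ^ 2) (B := 4 * M ^ 2)
    (by positivity) (fun N hN => ?_) (fun N => ?_)
  · refine le_of_eq_of_le ?_ (le_qfiCoherence c h_herm h_diag hm hm' hN ρ hst)
    congr 1; ring
  · refine (qfiCoherence_le c h_diag hd hM N hρ.1).trans_eq ?_
    congr 1; ring

theorem asymptoticQFICoherence_of_isIncoherent (h_diag : ∀ i, (h i).IsDiag)
    (hρ : IsIncoherent ρ) : asymptoticQFICoherence c h ρ = 0 := by
  rw [asymptoticQFICoherence, (tendsto_qfiLogRatio_of_isIncoherent h_diag hρ).limUnder_eq]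
  -- In `EReal`, `⊥ - 1 = ⊥`, so the maximum with `0` is `0`.
  simp

theorem asymptoticQFICoherence_of_isCoherent (h_herm : ∀ i, (h i).IsHermitian)
    (h_diag : ∀ i, (h i).IsDiag) {m M : ℝ} (hm : 0 < m) (hm' : ∀ i, m ≤ spectralSpread (h i))
    (hM : ∀ i, spectralSpread (h i) ≤ M) (hρ : IsCoherent ρ) :
    asymptoticQFICoherence c h ρ = 1 := by
  rw [asymptoticQFICoherence,
    (tendsto_qfiLogRatio_of_isCoherent h_herm h_diag hm hm' hM hρ).limUnder_eq]
  have h1 : (2 : EReal) - 1 = 1 := by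
    change ((2 : ℝ) : EReal) - ((1 : ℝ) : EReal) = ((1 : ℝ) : EReal)
    rw [← EReal.coe_sub]
    norm_num
  rw [h1, max_eq_left zero_le_one]

end Asymptotic

theorem mainTheorem8 {S : Type*} [Fintype S] [DecidableEq S] (c : IncoherentOpClass)
    (d : ℕ → ℕ) (h : (i : ℕ) → Matrix (Fin (d i)) (Fin (d i)) ℂ)
    (h_herm : ∀ i, (h i).IsHermitian) (h_diag : ∀ i, (h i).IsDiag)
    (h_lower : ∃ m : ℝ, 0 < m ∧ ∀ i, m ≤ spectralSpread (h i))
    (h_upper : ∃ M : ℝ, ∀ i, spectralSpread (h i) ≤ M)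
    (ρ : Matrix S S ℂ) (hρ : IsState ρ) :
    (∃ L : EReal, Tendsto (qfiLogRatio c h ρ) atTop (𝓝 L)) ∧
      (asymptoticQFICoherence c h ρ = 1 ↔ IsCoherent ρ) ∧
      (asymptoticQFICoherence c h ρ = 0 ↔ IsIncoherent ρ) := by
  obtain ⟨m, hm, hm'⟩ := h_lower
  obtain ⟨M, hM⟩ := h_upper
  by_cases hi : IsIncoherent ρ
  · have h0 := asymptoticQFICoherence_of_isIncoherent (c := c) h_diag hi
    refine ⟨⟨⊥, tendsto_qfiLogRatio_of_isIncoherent h_diag hi⟩, ?_, iff_of_true h0 hi⟩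
    exact iff_of_false (by rw [h0]; exact zero_ne_one) fun hc => hc.2 hi
  · have hc : IsCoherent ρ := ⟨hρ, hi⟩
    have h1 := asymptoticQFICoherence_of_isCoherent (c := c) h_herm h_diag hm hm' hM hc
    refine ⟨⟨2, tendsto_qfiLogRatio_of_isCoherent h_herm h_diag hm hm' hM hc⟩,
      iff_of_true h1 hc, ?_⟩
    exact iff_of_false (by rw [h1]; exact one_ne_zero) hi
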